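/- Let $M\subseteq\mathcal B(\mathcal H)$ be a von Neumann algebra acting on an arbitrary complex Hilbert space $\mathcal H$ and assume that its predual $M_*$, that is, the Banach space of ultraweakly continuous linear functionals on $M$ with the norm inherited from $M^*$, is norm-separable. Let $(M)_1$ be the closed unit ball of $M$, endowed with the weak (operator) topology. Let $\mathcal G_{w*}(M)$ be the set of all ultraweakly closed linear subspaces $V$ of $M$, where each $V$ is identified with its closed unit ball $(V)_1=\{x\in V:\|x\|\le 1\}\subseteq (M)_1$, and endow $\mathcal G_{w*}(M)$ with the topology induced by the Vietoris topology on subsets of $(M)_1$, i.e. the topology generated by the sets $\{V: (V)_1\cap U\neq\emptyset\}$ and $\{V:(V)_1\subseteq U\}$, where $U$ ranges over the weakly open subsets of $(M)_1$. Then there is a sequence of continuous maps $x_n:\mathcal G_{w*}(M)\to (M)_1$, $n\in\mathbb N$, such that for every $V\in\mathcal G_{w*}(M)$ all the $x_n(V)$ lie in $(V)_1$ and the set $\{x_n(V):n\in\mathbb N\}$ is dense in $(V)_1$ for the weak topology. -/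

import Mathlib

noncomputable section

open scoped Topology

namespace VonNeumannAlgebra

variable {H : Type*} [NormedAddCommGroup H] [InnerProductSpace ℂ H]

/-- For square-summable sequences of vectors, the series that defines an ultraweakly continuous
functional converges. -/
theorem summable_inner_apply (x : H →L[ℂ] H) (ξ η : ℕ → H)
    (hξ : Summable fun n => ‖ξ n‖ ^ 2) (hη : Summable fun n => ‖η n‖ ^ 2) :
    Summable fun n => inner ℂ (η n) (x (ξ n)) := by
  refine Summable.of_norm_bounded (g := fun n => ‖x‖ * (‖ξ n‖ ^ 2 + ‖η n‖ ^ 2))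
    ((hξ.add hη).mul_left _) fun n => ?_
  have h1 : ‖inner ℂ (η n) (x (ξ n))‖ ≤ ‖η n‖ * (‖x‖ * ‖ξ n‖) :=
    (norm_inner_le_norm _ _).trans (by gcongr; exact x.le_opNorm _)
  have h2 : ‖η n‖ * ‖ξ n‖ ≤ ‖ξ n‖ ^ 2 + ‖η n‖ ^ 2 := by
    nlinarith [sq_nonneg (‖ξ n‖ - ‖η n‖), sq_nonneg (‖ξ n‖), sq_nonneg (‖η n‖)]
  nlinarith [mul_le_mul_of_nonneg_left h2 (norm_nonneg x)]

variable (H) in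
/-- The ultraweak (or `σ`-weak) topology on `B(H)`: the coarsest topology that makes
`x ↦ ∑ₙ ⟨x ξₙ, ηₙ⟩` continuous for all sequences of vectors with `∑ₙ ‖ξₙ‖² < ∞` and
`∑ₙ ‖ηₙ‖² < ∞`. These functionals are exactly the `x ↦ Tr (T x)` with `T` of trace class. -/
@[reducible] def ultraweakTopologyBH : TopologicalSpace (H →L[ℂ] H) :=
  ⨅ (ξ : ℕ → H) (η : ℕ → H) (_ : Summable fun n => ‖ξ n‖ ^ 2)
    (_ : Summable fun n => ‖η n‖ ^ 2),
    TopologicalSpace.induced (fun x : H →L[ℂ] H => ∑' n, inner ℂ (η n) (x (ξ n))) inferInstance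

variable [CompleteSpace H]

/-- The ultraweak topology on a von Neumann algebra `M ⊆ B(H)`. -/
@[reducible] def ultraweakTopology (M : VonNeumannAlgebra H) :
    TopologicalSpace M.toStarSubalgebra :=
  TopologicalSpace.induced Subtype.val (ultraweakTopologyBH H)

/-- The predual `M_*` of a von Neumann algebra `M`: the space of ultraweakly continuous linear
functionals on `M`, with the norm of the dual of the Banach space `M`. -/
def predual (M : VonNeumannAlgebra H) : Submodule ℂ (StrongDual ℂ M.toStarSubalgebra) where
  carrier := {φ | Continuous[M.ultraweakTopology, inferInstance] φ}
  add_mem' {φ ψ} hφ hψ := by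
    let _ := M.ultraweakTopology
    exact Continuous.add (X := M.toStarSubalgebra) hφ hψ
  zero_mem' := @continuous_const _ _ M.ultraweakTopology _ 0
  smul_mem' c φ hφ := by
    let _ := M.ultraweakTopology
    exact Continuous.const_smul (β := M.toStarSubalgebra) hφ c

/-- The closed unit ball `(M)₁` of `M`, as a set of operators in the type of operators that
carries the weak operator topology; its subspace topology is the weak topology on `(M)₁`. -/
def weakUnitBall (M : VonNeumannAlgebra H) : Set (H →WOT[ℂ] H) :=
  {x | x.toCLM ∈ M.toStarSubalgebra ∧ ‖x.toCLM‖ ≤ 1}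

/-- The grassmannian of `M`: the set of all ultraweakly closed linear subspaces of `M`. -/
structure Grassmannian (M : VonNeumannAlgebra H) where
  toSubmodule : Submodule ℂ M.toStarSubalgebra
  isClosed : IsClosed[M.ultraweakTopology] (toSubmodule : Set M.toStarSubalgebra)

/-- The closed unit ball `(V)₁` of `V`, as a subset of `(M)₁`. -/
def Grassmannian.unitBall {M : VonNeumannAlgebra H} (V : M.Grassmannian) :
    Set M.weakUnitBall :=
  {x | (⟨x.1.toCLM, x.2.1⟩ : M.toStarSubalgebra) ∈ V.toSubmodule}

/-- The Vietoris topology on the grassmannian: a subspace `V` is identified with its closed unit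
ball `(V)₁`, a subset of `(M)₁`, and the subsets of `(M)₁` carry the Vietoris topology
associated to the weak topology on `(M)₁`. -/
instance (M : VonNeumannAlgebra H) : TopologicalSpace M.Grassmannian :=
  TopologicalSpace.induced Grassmannian.unitBall
    (TopologicalSpace.vietoris M.weakUnitBall)

end VonNeumannAlgebra

end

/-! The ball (M)₁ is weakly compact, and a norm-dense sequence in M_*, suitably scaled, maps it
affinely, injectively and continuously into ℓ², hence homeomorphically onto its image. There each
(V)₁ becomes compact and convex, so every y in (M)₁ has a unique nearest point in (V)₁, and
uniqueness with compactness makes that point Vietoris-continuous in V. Letting y run through a dense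
sequence of (M)₁ gives the selections. The metric argument is `exists_dense_continuous_selections`,
the map into ℓ² is `exists_continuous_lp_two`; `isCompact_weakOperator_closedBall` and
`continuous_ballInclusion` supply compactness and continuity of the coordinates. -/

/-- Nearest-point selections: a Vietoris-continuous family of nonempty closed subsets of a compact
space which become midpoint convex in an inner product space has a dense sequence of continuous
selections. -/
theorem exists_dense_continuous_selections {X E G : Type*} [TopologicalSpace X] [CompactSpace X]
    [NormedAddCommGroup E] [InnerProductSpace ℂ E] [TopologicalSpace G] {f : X → E}
    (hf : Continuous f) (hinj : Function.Injective f) {K : G → Set X}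
    (hK : @Continuous _ _ _ (TopologicalSpace.vietoris X) K)
    (hcl : ∀ V, IsClosed (K V)) (hne : ∀ V, (K V).Nonempty) [Nonempty X]
    (hmid : ∀ V, ∀ a ∈ K V, ∀ b ∈ K V, ∃ c ∈ K V, f c = (2⁻¹ : ℂ) • (f a + f b)) :
    ∃ x : ℕ → G → X, (∀ n, Continuous (x n)) ∧
      ∀ V, (∀ n, x n V ∈ K V) ∧ K V ⊆ closure (Set.range fun n => x n V) := by
  have hemb : Topology.IsClosedEmbedding f :=
    haveI : T2Space X := T2Space.of_injective_continuous hinj hf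
    hf.isClosedEmbedding hinj
  have : TopologicalSpace.MetrizableSpace X := hemb.isEmbedding.metrizableSpace
  let _ : MetricSpace X := TopologicalSpace.metrizableSpaceMetric X
  have hex : ∀ (y : X) (V : G), ∃ p ∈ K V, ∀ a ∈ K V, ‖f p - f y‖ ≤ ‖f a - f y‖ := by
    intro y V
    have hg : Continuous fun a => ‖f a - f y‖ := by fun_prop
    exact (hcl V).isCompact.exists_isMinOn (hne V) hg.continuousOn
  choose p hp hmin using hex
  -- By the parallelogram law, the midpoint of two distinct minimizers would be strictly nearer to
  -- `y`.
  have huniq : ∀ y V, ∀ a ∈ K V, ‖f a - f y‖ ≤ ‖f (p y V) - f y‖ → a = p y V := by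
    intro y V a ha hle
    obtain ⟨c, hc, hfc⟩ := hmid V a ha _ (hp y V)
    have h1 := hmin y V c hc
    have h2 := parallelogram_law_with_norm ℂ (f a - f y) (f (p y V) - f y)
    have h3 : ‖f a - f y + (f (p y V) - f y)‖ = 2 * ‖f c - f y‖ := by
      have : f a - f y + (f (p y V) - f y) = (2 : ℂ) • (f c - f y) := by
        rw [hfc, smul_sub, smul_smul, two_smul ℂ (f y)]
        norm_num
        abel
      rw [this, norm_smul]
      norm_num
    rw [h3, sub_sub_sub_cancel_right] at h2
    apply hinj
    rw [← sub_eq_zero, ← norm_eq_zero]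
    have h4 := norm_nonneg (f a - f y)
    have h5 := norm_nonneg (f (p y V) - f y)
    nlinarith [norm_nonneg (f a - f (p y V))]
  have hcont : ∀ y, Continuous (p y) := by
    intro y
    rw [continuous_iff_continuousAt]
    intro V
    rw [ContinuousAt, (nhds_basis_opens _).tendsto_right_iff]
    rintro U ⟨hpU, hU⟩
    set d := ‖f (p y V) - f y‖ with hd
    have hg : Continuous fun z => ‖f z - f y‖ := by fun_prop
    -- By compactness and uniqueness, the part of `K V` outside `U` stays at distance more than some
    -- `r > d` from `y`.
    obtain ⟨r, hdr, hr⟩ : ∃ r, d < r ∧ ∀ a ∈ K V, a ∉ U → r < ‖f a - f y‖ := by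
      have hc : IsCompact (K V \ U) := ((hcl V).sdiff hU).isCompact
      rcases (K V \ U).eq_empty_or_nonempty with he | hn
      · refine ⟨d + 1, by linarith, fun a ha haU => ?_⟩
        have : a ∈ K V \ U := ⟨ha, haU⟩
        simp [he] at this
      · obtain ⟨b, hb, hbm⟩ := hc.exists_isMinOn hn hg.continuousOn
        have hlt : d < ‖f b - f y‖ := by
          by_contra! h
          exact hb.2 (huniq y V b hb.1 h ▸ hpU)
        obtain ⟨r, h1, h2⟩ := exists_between hlt
        exact ⟨r, h1, fun a ha haU => h2.trans_le (hbm ⟨ha, haU⟩)⟩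
    -- For `W` near `V`, `K W` has a point at distance less than `r`, while its points outside `U`
    -- are farther than `r`; so the nearest point lies in `U`.
    have o1 : IsOpen {W | (K W ∩ {z | ‖f z - f y‖ < r}).Nonempty} :=
      @IsOpen.preimage _ _ _ (TopologicalSpace.vietoris X) _ hK _
        (TopologicalSpace.vietoris.isOpen_inter_nonempty_of_isOpen (isOpen_lt hg continuous_const))
    have o2 : IsOpen {W | K W ⊆ U ∪ {z | r < ‖f z - f y‖}} :=
      @IsOpen.preimage _ _ _ (TopologicalSpace.vietoris X) _ hK _
        (hU.union (isOpen_lt continuous_const hg)).powerset_vietoris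
    filter_upwards [o1.mem_nhds ⟨p y V, hp y V, hdr⟩, o2.mem_nhds fun a ha =>
      or_iff_not_imp_left.2 (hr a ha)] with W hW1 hW2
    obtain ⟨z, hzW, hz⟩ := hW1
    exact (hW2 (hp y W)).resolve_right (not_lt.2 ((hmin y W z hzW).trans (le_of_lt hz)))
  refine ⟨fun n => p (TopologicalSpace.denseSeq X n), fun n => hcont _, fun V =>
    ⟨fun n => hp _ V, fun a ha => ?_⟩⟩
  have hcl' : f a ∈ closure (f '' Set.range fun n => p (TopologicalSpace.denseSeq X n) V) := by
    rw [Metric.mem_closure_iff]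
    intro ε hε
    obtain ⟨n, hn⟩ := (TopologicalSpace.denseRange_denseSeq X).exists_mem_open
      (isOpen_lt (continuous_const.dist hf) continuous_const : IsOpen {z | dist (f a) (f z) < ε / 2})
      ⟨a, by simpa using hε⟩
    refine ⟨_, ⟨_, ⟨n, rfl⟩, rfl⟩, ?_⟩
    -- The point `a` itself competes, so the nearest point is within `ε / 2` of the chosen dense
    -- point.
    have h1 := hmin (TopologicalSpace.denseSeq X n) V a ha
    rw [← dist_eq_norm, ← dist_eq_norm] at h1
    have h2 : dist (f a) (f (TopologicalSpace.denseSeq X n)) < ε / 2 := hn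
    linarith [dist_triangle_right (f a) (f (p (TopologicalSpace.denseSeq X n) V))
      (f (TopologicalSpace.denseSeq X n))]
  rw [hemb.isInducing.closure_eq_preimage_closure_image]
  exact hcl'

/-- Countably many bounded continuous functions are, after rescaling, the coordinates of a continuous
map into `ℓ²`. -/
theorem exists_continuous_lp_two {X : Type*} [TopologicalSpace X] (g : ℕ → X → ℂ)
    (hg : ∀ n, Continuous (g n)) (C : ℕ → ℝ) (hC : ∀ n x, ‖g n x‖ ≤ C n) :
    ∃ (c : ℕ → ℂ) (f : X → lp (fun _ : ℕ => ℂ) 2), (∀ n, c n ≠ 0) ∧ Continuous f ∧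
      ∀ x n, f x n = c n * g n x := by
  have hpos : ∀ n, 0 < 1 + |C n| := fun n => by positivity
  -- The scaling bounds the `n`-th coordinate by `2⁻ⁿ`; then `f` is a uniform limit of finite sums
  -- of continuous maps.
  set c : ℕ → ℂ := fun n => (((1 / 2 : ℝ) ^ n / (1 + |C n|) : ℝ) : ℂ) with hc
  have hb : ∀ x n, ‖c n * g n x‖ ≤ (1 / 2 : ℝ) ^ n := fun x n => by
    rw [norm_mul, hc, Complex.norm_real, Real.norm_of_nonneg (by positivity), div_mul_eq_mul_div,
      div_le_iff₀ (hpos n)]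
    gcongr
    linarith [hC n x, le_abs_self (C n)]
  have hmem : ∀ x, Memℓp (fun n => c n * g n x) 2 := fun x => by
    refine memℓp_gen ?_
    refine Summable.of_nonneg_of_le (fun n => by positivity) (fun n => ?_)
      (summable_geometric_of_lt_one (r := (1 / 4 : ℝ)) (by norm_num) (by norm_num))
    have := hb x n
    rw [ENNReal.toReal_ofNat, Real.rpow_ofNat]
    calc ‖c n * g n x‖ ^ 2 ≤ ((1 / 2 : ℝ) ^ n) ^ 2 := by gcongr
      _ = (1 / 4 : ℝ) ^ n := by rw [← pow_mul, mul_comm, pow_mul]; norm_num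
  refine ⟨c, fun x => ⟨fun n => c n * g n x, hmem x⟩, fun n => ?_, ?_, fun x n => rfl⟩
  · rw [hc]
    exact Complex.ofReal_ne_zero.2 (by have := hpos n; positivity)
  · have key : (fun x => (⟨fun n => c n * g n x, hmem x⟩ : lp (fun _ : ℕ => ℂ) 2)) =
        fun x => ∑' n, lp.single 2 n (c n * g n x) := by
      funext x
      exact (lp.hasSum_single (p := 2) (by norm_num) _).tsum_eq.symm
    rw [key]
    refine continuous_tsum (fun n => ?_) summable_geometric_two fun n x => ?_
    · exact (lp.isometry_single n).continuous.comp
        (continuous_const.mul (hg n))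
    · rw [lp.norm_single (by norm_num)]
      exact hb x n
-- Weak operator and ultraweak topologies on the unit ball
namespace VonNeumannAlgebra

open Filter ContinuousLinearMapWOT
open scoped Topology InnerProductSpace

variable {H : Type*} [NormedAddCommGroup H] [InnerProductSpace ℂ H] [CompleteSpace H]

/-- The closed unit ball of `B(H)` is compact in the weak operator topology. -/
theorem isCompact_weakOperator_closedBall : IsCompact {x : H →WOT[ℂ] H | ‖x.toCLM‖ ≤ 1} := by
  rw [isCompact_iff_ultrafilter_le_nhds]
  intro F hF
  have hb : ∀ᶠ x : H →WOT[ℂ] H in F, ‖x.toCLM‖ ≤ 1 := le_principal_iff.1 hF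
  -- Bounded matrix coefficients converge along an ultrafilter; their limits form a bounded
  -- sesquilinear form, which represents the limit operator.
  have hlim : ∀ ξ η : H, ∃ b : ℂ, ‖b‖ ≤ ‖ξ‖ * ‖η‖ ∧
      Tendsto (fun x : H →WOT[ℂ] H => ⟪x ξ, η⟫_ℂ) F (𝓝 b) := by
    intro ξ η
    have hmem : ∀ᶠ x : H →WOT[ℂ] H in F, ⟪x ξ, η⟫_ℂ ∈ Metric.closedBall (0 : ℂ) (‖ξ‖ * ‖η‖) := by
      filter_upwards [hb] with x hx
      rw [mem_closedBall_zero_iff]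
      refine (norm_inner_le_norm _ _).trans ?_
      gcongr
      exact (x.toCLM.le_of_opNorm_le hx ξ).trans_eq (one_mul _)
    obtain ⟨b, hb1, hb2⟩ := (isCompact_closedBall (0 : ℂ) (‖ξ‖ * ‖η‖)).ultrafilter_le_nhds
      (F.map fun x : H →WOT[ℂ] H => ⟪x ξ, η⟫_ℂ) (le_principal_iff.2 hmem)
    exact ⟨b, by simpa using hb1, hb2⟩
  choose b hbound hb using hlim
  let B : H →L⋆[ℂ] H →L[ℂ] ℂ := LinearMap.mkContinuous₂
    (LinearMap.mk₂'ₛₗ (starRingEnd ℂ) (RingHom.id ℂ) b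
      (fun ξ ξ' η => tendsto_nhds_unique (hb _ _)
        (((hb ξ η).add (hb ξ' η)).congr fun x => by rw [map_add, inner_add_left]))
      (fun c ξ η => tendsto_nhds_unique (hb _ _)
        (((hb ξ η).const_mul _).congr fun x => by rw [map_smul, inner_smul_left]))
      (fun ξ η η' => tendsto_nhds_unique (hb _ _)
        (((hb ξ η).add (hb ξ η')).congr fun x => by rw [inner_add_right]))
      (fun c ξ η => tendsto_nhds_unique (hb _ _)
        (((hb ξ η).const_mul _).congr fun x => by rw [inner_smul_right]; rfl)))
    1 (fun ξ η => by simpa using hbound ξ η)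
  let A : H →L[ℂ] H := InnerProductSpace.continuousLinearMapOfBilin B
  have hA : ∀ ξ η, ⟪A ξ, η⟫_ℂ = b ξ η := fun ξ η =>
    InnerProductSpace.continuousLinearMapOfBilin_apply B ξ η
  refine ⟨ofCLM A, ?_, ?_⟩
  · refine A.opNorm_le_bound zero_le_one fun ξ => ?_
    rw [one_mul]
    have h := hbound ξ (A ξ)
    rw [← hA, inner_self_eq_norm_sq_to_K] at h
    by_contra! hlt
    have h0 : 0 < ‖A ξ‖ := (norm_nonneg _).trans_lt hlt
    have h1 : ‖A ξ‖ ^ 2 ≤ ‖ξ‖ * ‖A ξ‖ := by simpa using h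
    nlinarith
  · rw [le_nhds_iff_forall_inner_apply_le_nhds]
    intro ξ η
    have h := (Complex.continuous_conj.tendsto _).comp (hb ξ η)
    rw [← hA, inner_conj_symm] at h
    exact h.congr fun x => inner_conj_symm _ _

theorem continuous_inner_apply_weakOperator (ξ η : H) :
    Continuous fun x : H →WOT[ℂ] H => ⟪η, x ξ⟫_ℂ :=
  ContinuousLinearMapWOT.continuous_iff.1 continuous_id ξ η

/-- A von Neumann algebra is closed in the weak operator topology. -/
theorem isClosed_weakOperator (M : VonNeumannAlgebra H) :
    IsClosed {x : H →WOT[ℂ] H | x.toCLM ∈ M.toStarSubalgebra} := by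
  -- By the double commutant theorem, membership means commuting with every `a` in the commutant, a
  -- condition on matrix coefficients.
  have : {x : H →WOT[ℂ] H | x.toCLM ∈ M.toStarSubalgebra} =
      ⋂ a ∈ M.commutant, ⋂ ξ : H, ⋂ η : H, {x | ⟪star a η, x ξ⟫_ℂ = ⟪η, x (a ξ)⟫_ℂ} := by
    ext x
    have h : x.toCLM ∈ M.toStarSubalgebra ↔ x.toCLM ∈ M.commutant.commutant := by
      rw [commutant_commutant]; rfl
    simp only [Set.mem_ofPred_eq, h, mem_commutant_iff (S := M.commutant), Set.mem_iInter]
    refine forall₂_congr fun a _ => ?_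
    simp only [ContinuousLinearMap.star_eq_adjoint, ContinuousLinearMap.adjoint_inner_left]
    constructor
    · intro hx ξ η
      exact congrArg (fun y => ⟪η, y⟫_ℂ) (DFunLike.congr_fun hx ξ)
    · intro hx
      ext ξ
      exact ext_inner_left ℂ (hx ξ)
  rw [this]
  exact isClosed_biInter fun a _ => isClosed_iInter fun ξ => isClosed_iInter fun η =>
    isClosed_eq (continuous_inner_apply_weakOperator _ _) (continuous_inner_apply_weakOperator _ _)

instance (M : VonNeumannAlgebra H) : CompactSpace M.weakUnitBall :=
  isCompact_iff_compactSpace.1 (isCompact_weakOperator_closedBall.inter_left M.isClosed_weakOperator)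

/-- The inclusion of the unit ball, with the weak operator topology, into the algebra. -/
def ballInclusion (M : VonNeumannAlgebra H) (x : M.weakUnitBall) : M.toStarSubalgebra :=
  ⟨x.1.toCLM, x.2.1⟩

/-- On the unit ball the weak operator topology is finer than the ultraweak topology. -/
theorem continuous_ballInclusion (M : VonNeumannAlgebra H) :
    Continuous[inferInstance, M.ultraweakTopology] M.ballInclusion := by
  rw [continuous_induced_rng]
  refine continuous_iInf_rng.2 fun ξ => continuous_iInf_rng.2 fun η => continuous_iInf_rng.2 fun hξ =>
    continuous_iInf_rng.2 fun hη => continuous_induced_rng.2 ?_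
  -- On the unit ball the terms have a summable bound independent of `x`, so the series converges
  -- uniformly.
  refine continuous_tsum (u := fun n => ‖ξ n‖ ^ 2 + ‖η n‖ ^ 2) (fun n => ?_) (hξ.add hη)
    fun n x => ?_
  · exact (continuous_inner_apply_weakOperator (ξ n) (η n)).comp continuous_subtype_val
  · have h : ‖x.1.toCLM (ξ n)‖ ≤ ‖ξ n‖ :=
      (x.1.toCLM.le_of_opNorm_le x.2.2 _).trans_eq (one_mul _)
    refine (norm_inner_le_norm (η n) (x.1.toCLM (ξ n))).trans ?_
    nlinarith [sq_nonneg (‖ξ n‖ - ‖η n‖), sq_nonneg (‖ξ n‖), sq_nonneg (‖η n‖),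
      mul_le_mul_of_nonneg_left h (norm_nonneg (η n))]

theorem Grassmannian.isClosed_unitBall {M : VonNeumannAlgebra H} (V : M.Grassmannian) :
    IsClosed V.unitBall :=
  @IsClosed.preimage _ _ _ M.ultraweakTopology _ M.continuous_ballInclusion _ V.isClosed

/-- The vector functional `x ↦ ⟨x ξ, η⟩`, as an element of the predual. -/
noncomputable def vectorFunctional (M : VonNeumannAlgebra H) (ξ η : H) : M.predual :=
  ⟨(innerSL ℂ η ∘L ContinuousLinearMap.apply ℂ H ξ) ∘L
    M.toStarSubalgebra.toSubalgebra.toSubmodule.subtypeL, by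
    have hsum : ∀ ζ : H, Summable fun n : ℕ => ‖(if n = 0 then ζ else 0 : H)‖ ^ 2 := fun ζ =>
      summable_of_ne_finset_zero (s := {0}) fun n hn => by
        rw [if_neg (by simpa using hn)]; simp
    have h1 : Continuous[ultraweakTopologyBH H, inferInstance]
        fun x : H →L[ℂ] H => ∑' n : ℕ, ⟪(if n = 0 then η else 0 : H),
          x (if n = 0 then ξ else 0)⟫_ℂ :=
      continuous_iff_le_induced.2 (iInf_le_of_le _ (iInf_le_of_le _
        (iInf_le_of_le (hsum ξ) (iInf_le_of_le (hsum η) le_rfl))))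
    have h2 : (fun x : H →L[ℂ] H => ∑' n : ℕ, ⟪(if n = 0 then η else 0 : H),
        x (if n = 0 then ξ else 0)⟫_ℂ) = fun x => ⟪η, x ξ⟫_ℂ := by
      funext x
      rw [tsum_eq_single 0 fun n hn => by simp [hn]]
      simp
    rw [h2] at h1
    exact @Continuous.comp _ _ _ M.ultraweakTopology (ultraweakTopologyBH H) _ _ _ h1
      continuous_induced_dom⟩

end VonNeumannAlgebra

open VonNeumannAlgebra in
theorem mainTheorem8 {H : Type*} [NormedAddCommGroup H] [InnerProductSpace ℂ H] [CompleteSpace H]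
    (M : VonNeumannAlgebra H) (hM : TopologicalSpace.SeparableSpace M.predual) :
    ∃ x : ℕ → M.Grassmannian → M.weakUnitBall,
      (∀ n, Continuous (x n)) ∧
      ∀ V : M.Grassmannian,
        (∀ n, x n V ∈ V.unitBall) ∧ V.unitBall ⊆ closure (Set.range fun n => x n V) := by
  let φ : ℕ → M.predual := TopologicalSpace.denseSeq M.predual
  have hnorm : ∀ x : M.weakUnitBall, ‖M.ballInclusion x‖ ≤ 1 := fun x => x.2.2
  have hcont : ∀ n, Continuous fun x : M.weakUnitBall => (φ n).1 (M.ballInclusion x) := fun n =>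
    @Continuous.comp _ _ _ _ M.ultraweakTopology _ _ _ (φ n).2 M.continuous_ballInclusion
  obtain ⟨c, f, hc, hf, hfc⟩ := exists_continuous_lp_two
    (fun n (x : M.weakUnitBall) => (φ n).1 (M.ballInclusion x)) hcont (fun n => ‖(φ n).1‖)
    fun n x => (φ n).1.unit_le_opNorm _ (hnorm x)
  have hinj : Function.Injective f := by
    intro x y hxy
    have h1 : ∀ n, (φ n).1 (M.ballInclusion x) = (φ n).1 (M.ballInclusion y) := fun n =>
      mul_left_cancel₀ (hc n) (by rw [← hfc, ← hfc, hxy])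
    -- Evaluation at `z` is norm continuous, so agreement on the dense sequence extends to all of
    -- M_*, whose vector functionals separate operators.
    have hev : ∀ z : M.toStarSubalgebra, Continuous fun ψ : M.predual => ψ.1 z := fun z =>
      (ContinuousLinearMap.apply ℂ ℂ z).continuous.comp continuous_subtype_val
    have h2 : (fun ψ : M.predual => ψ.1 (M.ballInclusion x)) = fun ψ => ψ.1 (M.ballInclusion y) :=
      (TopologicalSpace.denseRange_denseSeq M.predual).equalizer (hev _) (hev _) (funext h1)
    refine Subtype.ext (ContinuousLinearMapWOT.ext_inner fun ξ η => ?_)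
    exact congrFun h2 (M.vectorFunctional ξ η)
  have hzero : ∀ V : M.Grassmannian, ∃ x, x ∈ V.unitBall := fun V =>
    ⟨⟨0, zero_mem M.toStarSubalgebra, by simp⟩, V.toSubmodule.zero_mem⟩
  have : Nonempty M.weakUnitBall := ⟨⟨0, zero_mem M.toStarSubalgebra, by simp⟩⟩
  refine exists_dense_continuous_selections hf hinj (K := Grassmannian.unitBall)
    continuous_induced_dom (fun V => V.isClosed_unitBall) hzero fun V a ha b hb => ?_
  have hmem : (2⁻¹ : ℂ) • (M.ballInclusion a + M.ballInclusion b) ∈ V.toSubmodule :=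
    V.toSubmodule.smul_mem _ (V.toSubmodule.add_mem ha hb)
  have hle : ‖(2⁻¹ : ℂ) • (M.ballInclusion a + M.ballInclusion b)‖ ≤ 1 := by
    rw [norm_smul, norm_inv, Complex.norm_ofNat]
    linarith [norm_add_le (M.ballInclusion a) (M.ballInclusion b), hnorm a, hnorm b]
  refine ⟨⟨.ofCLM ((2⁻¹ : ℂ) • (M.ballInclusion a + M.ballInclusion b)).1,
    ((2⁻¹ : ℂ) • (M.ballInclusion a + M.ballInclusion b)).2, hle⟩, hmem, ?_⟩
  -- Each coordinate of `f` is a multiple of a linear functional, so midpoints go to midpoints.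
  ext n
  rw [lp.coeFn_smul, lp.coeFn_add, Pi.smul_apply, Pi.add_apply, hfc, hfc, hfc, ← mul_add, ← map_add,
    smul_eq_mul, mul_left_comm, ← smul_eq_mul (2⁻¹ : ℂ), ← map_smul]
  rfl
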